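/- Here $L^\infty(\mathbb R)$ is the von Neumann algebra of essentially bounded complex-valued Lebesgue measurable functions on $\mathbb R$ (modulo null sets), with its weak* topology as the dual of $L^1(\mathbb R)$, and $\odot$ denotes the algebraic tensor product over $\mathbb C$. Let $M$ and $N$ be von Neumann algebras. If $\alpha\colon M\odot N\to B(H)$ is an injective unital $*$-representation on a Hilbert space $H$ such that the restrictions $a\mapsto\alpha(a\otimes 1)$ and $b\mapsto\alpha(1\otimes b)$ are weak* homeomorphisms onto their ranges, then the weak* closure $M\overline\otimes_\alpha N$ of $\alpha(M\odot N)$ in $B(H)$ is called a weak* tensor product completion of $M\odot N$. Two such completions $M\overline\otimes_\alpha N$ and $M\overline\otimes_\beta N$ are equivalent if the map $\alpha(a\otimes b)\mapsto\beta(a\otimes b)$ ($a\in M$, $b\in N$) extends to a (necessarily normal) $*$-isomorphism of $M\overline\otimes_\alpha N$ onto $M\overline\otimes_\beta N$. For $x\in\mathbb R$ let $\mu_x$ be the measure on $\mathbb R\times\mathbb R$ given by $\int f\,d\mu_x=\int_{\mathbb R}f(y,x+y)\,dy$, that is, the image of Lebesgue measure under $y\mapsto(y,x+y)$. Let $\pi_x$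 be the representation of $L^\infty(\mathbb R)\odot L^\infty(\mathbb R)$ on $L^2(\mathbb R\times\mathbb R,\mu_x)$ in which $f\otimes g$ acts as multiplication by the function $(s,t)\mapsto f(s)g(t)$, and let $\sigma$ be the representation of $L^\infty(\mathbb R)\odot L^\infty(\mathbb R)$ on $L^2(\mathbb R\times\mathbb R)$ (with Lebesgue measure) given by the same formula. For $S\subset\mathbb R$ put $$\alpha_S=\bigoplus_{x\in S}\pi_x\oplus\sigma .$$ **Theorem.** For every subset $S\subset\mathbb R$, the representation $\alpha_S$ defines a weak* tensor product completion $L^\infty(\mathbb R)\overline\otimes_{\alpha_S}L^\infty(\mathbb R)$ of $L^\infty(\mathbb R)\odot L^\infty(\mathbb R)$, and the completions defined by $\alpha_S$ and $\alpha_T$ are not equivalent whenever $S\neq T$. Since $\mathbb R$ has $2^{\mathfrak c}$ subsets, $L^\infty(\mathbb R)\odot L^\infty(\mathbb R)$ admits $2^{\mathfrak c}$ pairwise nonequivalent weak* tensor product completions. -/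

import Mathlib

open MeasureTheory TensorProduct Topology
open scoped ENNReal InnerProductSpace

noncomputable section

/-! ### The von Neumann algebra `L^∞(X, μ)` with its weak* topology -/

section LInfty

variable {X Y : Type*} [MeasurableSpace X] [MeasurableSpace Y]

/-- The algebra `L^∞(X, μ)` of (classes of) essentially bounded complex functions. It is a copy of
`MeasureTheory.Lp ℂ ∞ μ` which carries the pointwise `*`-algebra structure and the weak* topology
instead of the norm topology. -/
def LInfty (μ : Measure X) : Type _ := Lp ℂ ∞ μ

namespace LInfty

variable {μ : Measure X} {ν : Measure Y}

instance : AddCommGroup (LInfty μ) := inferInstanceAs (AddCommGroup (Lp ℂ ∞ μ))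

instance : Module ℂ (LInfty μ) := inferInstanceAs (Module ℂ (Lp ℂ ∞ μ))

/-- The underlying element of the Banach space `Lp ℂ ∞ μ`. -/
def toLp (f : LInfty μ) : Lp ℂ ∞ μ := f

instance : CoeFun (LInfty μ) (fun _ => X → ℂ) := ⟨fun f => f.toLp⟩

/-- The class of a measurable essentially bounded function. -/
def mk (f : X → ℂ) (hf : MemLp f ∞ μ) : LInfty μ := hf.toLp f

theorem coe_mk (f : X → ℂ) (hf : MemLp f ∞ μ) : mk f hf =ᵐ[μ] f := hf.coeFn_toLp

theorem memLp (f : LInfty μ) : MemLp (fun x => f x) ∞ μ := Lp.memLp f.toLp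

theorem ext {f g : LInfty μ} (h : f =ᵐ[μ] g) : f = g := Lp.ext (f := f.toLp) (g := g.toLp) h

instance : Mul (LInfty μ) := ⟨fun f g => mk (fun x => f x * g x) (MemLp.mul (p := ∞) (q := ∞) (r := ∞) g.memLp f.memLp)⟩

instance : One (LInfty μ) := ⟨mk (fun _ => 1) (memLp_top_const 1)⟩

instance : Star (LInfty μ) := ⟨fun f => mk (fun x => star (f x)) f.memLp.star⟩

theorem coe_zero : (0 : LInfty μ) =ᵐ[μ] fun _ => (0 : ℂ) := Lp.coeFn_zero ℂ ∞ μ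

theorem coe_add (f g : LInfty μ) : (f + g : LInfty μ) =ᵐ[μ] fun x => f x + g x :=
  Lp.coeFn_add f.toLp g.toLp

theorem coe_smul (c : ℂ) (f : LInfty μ) : (c • f : LInfty μ) =ᵐ[μ] fun x => c * f x :=
  Lp.coeFn_smul c f.toLp

theorem coe_mul (f g : LInfty μ) : (f * g : LInfty μ) =ᵐ[μ] fun x => f x * g x := coe_mk _ _

theorem coe_one : (1 : LInfty μ) =ᵐ[μ] fun _ => (1 : ℂ) := coe_mk _ _

theorem coe_star (f : LInfty μ) : (star f : LInfty μ) =ᵐ[μ] fun x => star (f x) := coe_mk _ _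

instance : CommRing (LInfty μ) where
  __ := (inferInstance : AddCommGroup (LInfty μ))
  mul_assoc f g h := ext <| by
    filter_upwards [coe_mul (f * g) h, coe_mul f (g * h), coe_mul f g, coe_mul g h]
      with x h1 h2 h3 h4
    rw [h1, h2, h3, h4, mul_assoc]
  mul_comm f g := ext <| by
    filter_upwards [coe_mul f g, coe_mul g f] with x h1 h2
    rw [h1, h2, mul_comm]
  one_mul f := ext <| by
    filter_upwards [coe_mul 1 f, coe_one (μ := μ)] with x h1 h2
    rw [h1, h2, one_mul]
  mul_one f := ext <| by
    filter_upwards [coe_mul f 1, coe_one (μ := μ)] with x h1 h2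
    rw [h1, h2, mul_one]
  zero_mul f := ext <| by
    filter_upwards [coe_mul 0 f, coe_zero (μ := μ)] with x h1 h2
    rw [h1, h2, zero_mul]
  mul_zero f := ext <| by
    filter_upwards [coe_mul f 0, coe_zero (μ := μ)] with x h1 h2
    rw [h1, h2, mul_zero]
  left_distrib f g h := ext <| by
    filter_upwards [coe_mul f (g + h), coe_add (f * g) (f * h), coe_add g h, coe_mul f g,
      coe_mul f h] with x h1 h2 h3 h4 h5
    rw [h1, h2, h3, h4, h5, mul_add]
  right_distrib f g h := ext <| by
    filter_upwards [coe_mul (f + g) h, coe_add (f * h) (g * h), coe_add f g, coe_mul f h,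
      coe_mul g h] with x h1 h2 h3 h4 h5
    rw [h1, h2, h3, h4, h5, add_mul]

instance : Algebra ℂ (LInfty μ) := Algebra.ofModule
  (fun c f g => ext <| by
    filter_upwards [coe_mul (c • f) g, coe_smul c (f * g), coe_smul c f, coe_mul f g]
      with x h1 h2 h3 h4
    rw [h1, h2, h3, h4, mul_assoc])
  (fun c f g => ext <| by
    filter_upwards [coe_mul f (c • g), coe_smul c (f * g), coe_smul c g, coe_mul f g]
      with x h1 h2 h3 h4
    rw [h1, h2, h3, h4, mul_left_comm])

instance : StarRing (LInfty μ) where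
  star_involutive f := ext <| by
    filter_upwards [coe_star (star f), coe_star f] with x h1 h2
    rw [h1, h2, star_star]
  star_mul f g := ext <| by
    filter_upwards [coe_star (f * g), coe_mul f g, coe_mul (star g) (star f), coe_star f,
      coe_star g] with x h1 h2 h3 h4 h5
    rw [h1, h2, h3, h4, h5, star_mul]
  star_add f g := ext <| by
    filter_upwards [coe_star (f + g), coe_add f g, coe_add (star f) (star g), coe_star f,
      coe_star g] with x h1 h2 h3 h4 h5
    rw [h1, h2, h3, h4, h5, star_add]

instance : StarModule ℂ (LInfty μ) where
  star_smul c f := ext <| by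
    filter_upwards [coe_star (c • f), coe_smul c f, coe_smul (star c) (star f), coe_star f]
      with x h1 h2 h3 h4
    rw [h1, h2, h3, h4, star_mul']

/-- The weak* topology `σ(L^∞(μ), L^1(μ))`: the coarsest topology for which every functional
`f ↦ ∫ f g dμ` with `g ∈ L^1(μ)` is continuous. -/
instance : TopologicalSpace (LInfty μ) :=
  TopologicalSpace.induced (fun (f : LInfty μ) (g : Lp ℂ 1 μ) => ∫ x, f x * g x ∂μ) inferInstance

/-- The `*`-homomorphism `L^∞(ν) → L^∞(μ)`, `f ↦ f ∘ φ`, for a map `φ` under which the preimage of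
a `ν`-null set is a `μ`-null set. -/
def comp (φ : X → Y) (hφ : Measure.QuasiMeasurePreserving φ μ ν) : LInfty ν →⋆ₐ[ℂ] LInfty μ :=
  have hmem (f : LInfty ν) : MemLp (fun x => f (φ x)) ∞ μ :=
    memLp_top_of_bound (f.memLp.1.comp_quasiMeasurePreserving hφ)
      (lpNorm (fun x => f x) ∞ ν) (hφ.ae (ae_le_lpNorm_exponent_top f.memLp))
  have hone : mk (fun x => (1 : LInfty ν) (φ x)) (hmem 1) = 1 := ext <| by
    filter_upwards [coe_mk _ (hmem 1), hφ.ae (coe_one (μ := ν)), coe_one (μ := μ)] with x h1 h2 h3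
    rw [h1, h2, h3]
  have hadd (f g : LInfty ν) : mk (fun x => (f + g : LInfty ν) (φ x)) (hmem (f + g)) =
      mk (fun x => f (φ x)) (hmem f) + mk (fun x => g (φ x)) (hmem g) := ext <| by
    filter_upwards [coe_mk _ (hmem (f + g)), hφ.ae (coe_add f g),
      coe_add (mk (fun x => f (φ x)) (hmem f)) (mk (fun x => g (φ x)) (hmem g)),
      coe_mk _ (hmem f), coe_mk _ (hmem g)] with x h1 h2 h3 h4 h5
    rw [h1, h2, h3, h4, h5]
  have hmul (f g : LInfty ν) : mk (fun x => (f * g : LInfty ν) (φ x)) (hmem (f * g)) =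
      mk (fun x => f (φ x)) (hmem f) * mk (fun x => g (φ x)) (hmem g) := ext <| by
    filter_upwards [coe_mk _ (hmem (f * g)), hφ.ae (coe_mul f g),
      coe_mul (mk (fun x => f (φ x)) (hmem f)) (mk (fun x => g (φ x)) (hmem g)),
      coe_mk _ (hmem f), coe_mk _ (hmem g)] with x h1 h2 h3 h4 h5
    rw [h1, h2, h3, h4, h5]
  have hsmul (c : ℂ) (f : LInfty ν) : mk (fun x => (c • f : LInfty ν) (φ x)) (hmem (c • f)) =
      c • mk (fun x => f (φ x)) (hmem f) := ext <| by
    filter_upwards [coe_mk _ (hmem (c • f)), hφ.ae (coe_smul c f),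
      coe_smul c (mk (fun x => f (φ x)) (hmem f)), coe_mk _ (hmem f)] with x h1 h2 h3 h4
    rw [h1, h2, h3, h4]
  have hstar (f : LInfty ν) : mk (fun x => (star f : LInfty ν) (φ x)) (hmem (star f)) =
      star (mk (fun x => f (φ x)) (hmem f)) := ext <| by
    filter_upwards [coe_mk _ (hmem (star f)), hφ.ae (coe_star f),
      coe_star (mk (fun x => f (φ x)) (hmem f)), coe_mk _ (hmem f)] with x h1 h2 h3 h4
    rw [h1, h2, h3, h4]
  { AlgHom.ofLinearMap
      { toFun := fun f => mk (fun x => f (φ x)) (hmem f)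
        map_add' := hadd
        map_smul' := hsmul } hone hmul with
    map_star' := hstar }

/-- The representation of `L^∞(μ)` on `L^2(μ)` by multiplication operators. -/
def mulRep (μ : Measure X) : LInfty μ →⋆ₐ[ℂ] (Lp ℂ 2 μ →L[ℂ] Lp ℂ 2 μ) :=
  let M : LInfty μ →ₗ[ℂ] (Lp ℂ 2 μ →L[ℂ] Lp ℂ 2 μ) :=
    (((ContinuousLinearMap.mul ℂ ℂ).holderL μ ∞ 2 2 : Lp ℂ ∞ μ →L[ℂ] _) : Lp ℂ ∞ μ →ₗ[ℂ] _)
  have hM (f : LInfty μ) (ξ : Lp ℂ 2 μ) : M f ξ =ᵐ[μ] fun x => f x * ξ x :=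
    (ContinuousLinearMap.mul ℂ ℂ).coeFn_holder f.toLp ξ
  have hone : M 1 = 1 := by
    refine ContinuousLinearMap.ext fun ξ => Lp.ext ?_
    filter_upwards [hM 1 ξ, coe_one (μ := μ)] with x h1 h2
    rw [h1, h2, one_mul]
    rfl
  have hmul (f g : LInfty μ) : M (f * g) = M f * M g := by
    refine ContinuousLinearMap.ext fun ξ => Lp.ext ?_
    filter_upwards [hM (f * g) ξ, coe_mul f g, hM f (M g ξ), hM g ξ] with x h1 h2 h3 h4
    rw [h1, h2, mul_apply_eq_comp, h3, h4, mul_assoc]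
  have hstar (f : LInfty μ) : M (star f) = star (M f) := by
    rw [ContinuousLinearMap.star_eq_adjoint, ContinuousLinearMap.eq_adjoint_iff]
    intro ξ η
    rw [L2.inner_def, L2.inner_def]
    refine integral_congr_ae ?_
    filter_upwards [hM (star f) ξ, coe_star f, hM f η] with x h1 h2 h3
    rw [h1, h2, h3]
    simp only [RCLike.inner_apply, map_mul, RCLike.star_def, Complex.conj_conj]
    ring
  { AlgHom.ofLinearMap M hone hmul with map_star' := hstar }

theorem mulRep_apply (f : LInfty μ) (ξ : Lp ℂ 2 μ) : mulRep μ f ξ =ᵐ[μ] fun x => f x * ξ x :=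
  (ContinuousLinearMap.mul ℂ ℂ).coeFn_holder f.toLp ξ

theorem comp_apply (φ : X → Y) (hφ : Measure.QuasiMeasurePreserving φ μ ν) (f : LInfty ν) :
    comp φ hφ f =ᵐ[μ] fun x => f (φ x) :=
  coe_mk _ (memLp_top_of_bound (f.memLp.1.comp_quasiMeasurePreserving hφ)
      (lpNorm (fun x => f x) ∞ ν) (hφ.ae (ae_le_lpNorm_exponent_top f.memLp)))

theorem norm_mulRep_comp_le (φ : X → Y) (hφ : Measure.QuasiMeasurePreserving φ μ ν)
    (f : LInfty ν) : ‖mulRep μ (comp φ hφ f)‖ ≤ lpNorm (fun x => f x) ∞ ν := by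
  refine ContinuousLinearMap.opNorm_le_bound _ lpNorm_nonneg fun ξ => ?_
  refine Lp.norm_le_mul_norm_of_ae_le_mul ?_
  filter_upwards [mulRep_apply (comp φ hφ f) ξ, comp_apply φ hφ f,
    hφ.ae (ae_le_lpNorm_exponent_top f.memLp)] with x h1 h2 h3
  rw [h1, h2, norm_mul]
  gcongr

end LInfty

end LInfty

/-! ### The weak* (ultraweak) topology on `B(H)` -/

section BoundedOperators

/-- The `*`-algebra `B(H)` of bounded operators on `H`, as a copy of `H →L[ℂ] H` which carries the
weak* topology instead of the norm topology. -/
def WeakStarB (H : Type*) [NormedAddCommGroup H] [InnerProductSpace ℂ H] : Type _ := H →L[ℂ] H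

variable {H : Type*} [NormedAddCommGroup H] [InnerProductSpace ℂ H]

namespace WeakStarB

instance : Ring (WeakStarB H) := inferInstanceAs (Ring (H →L[ℂ] H))

instance : Algebra ℂ (WeakStarB H) := inferInstanceAs (Algebra ℂ (H →L[ℂ] H))

instance [CompleteSpace H] : StarRing (WeakStarB H) := inferInstanceAs (StarRing (H →L[ℂ] H))

instance [CompleteSpace H] : StarModule ℂ (WeakStarB H) :=
  inferInstanceAs (StarModule ℂ (H →L[ℂ] H))

/-- The identity map from `B(H)` to its copy with the weak* topology. -/
def of (H : Type*) [NormedAddCommGroup H] [InnerProductSpace ℂ H] [CompleteSpace H] :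
    (H →L[ℂ] H) →⋆ₐ[ℂ] WeakStarB H :=
  StarAlgHom.id ℂ (H →L[ℂ] H)

/-- An element of the copy, regarded as a bounded operator. -/
def toCLM (T : WeakStarB H) : H →L[ℂ] H := T

/-- The functional `T ↦ ∑ₙ ⟨ξₙ, T ηₙ⟩` for square summable sequences `ξ`, `η` of vectors. -/
def functional (T : WeakStarB H) (p : lp (fun _ : ℕ => H) 2 × lp (fun _ : ℕ => H) 2) : ℂ :=
  ∑' n, ⟪p.1 n, T.toCLM (p.2 n)⟫_ℂ

/-- The weak* topology of `B(H)` as the dual of the trace class operators (the ultraweak topology):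
the coarsest topology for which every functional `T ↦ ∑ₙ ⟨ξₙ, T ηₙ⟩` with `∑ ‖ξₙ‖² < ∞` and
`∑ ‖ηₙ‖² < ∞` is continuous. -/
instance : TopologicalSpace (WeakStarB H) := TopologicalSpace.induced functional inferInstance

/-- A bounded operator applied to each term of a square summable sequence. -/
def ampl (T : H →L[ℂ] H) : lp (fun _ : ℕ => H) 2 →L[ℂ] lp (fun _ : ℕ => H) 2 :=
  lp.mapCLM 2 (fun _ => T) (norm_nonneg T) (fun _ => le_rfl)

theorem ampl_apply (T : H →L[ℂ] H) (ξ : lp (fun _ : ℕ => H) 2) (n : ℕ) :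
    ampl T ξ n = T (ξ n) := rfl

theorem functional_eq (T : WeakStarB H) (p : lp (fun _ : ℕ => H) 2 × lp (fun _ : ℕ => H) 2) :
    functional T p = ⟪p.1, ampl T.toCLM p.2⟫_ℂ :=
  (lp.inner_eq_tsum (𝕜 := ℂ) p.1 (ampl T.toCLM p.2)).symm

theorem continuous_functional (p : lp (fun _ : ℕ => H) 2 × lp (fun _ : ℕ => H) 2) :
    Continuous fun T : WeakStarB H => functional T p :=
  (continuous_apply p).comp (continuous_induced_dom (f := functional))

theorem continuous_of_functional {Z : Type*} [TopologicalSpace Z] {F : Z → WeakStarB H}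
    (hF : ∀ p, Continuous fun z => functional (F z) p) : Continuous F :=
  continuous_induced_rng.2 (continuous_pi hF)

theorem functional_add (S T : WeakStarB H) (p : lp (fun _ : ℕ => H) 2 × lp (fun _ : ℕ => H) 2) :
    functional (S + T) p = functional S p + functional T p := by
  have h : ampl (S + T).toCLM p.2 =
      ampl S.toCLM p.2 + ampl T.toCLM p.2 := lp.ext (funext fun _ => rfl)
  rw [functional_eq, functional_eq, functional_eq, h, inner_add_right]

theorem functional_mul_right (S T : WeakStarB H)
    (p : lp (fun _ : ℕ => H) 2 × lp (fun _ : ℕ => H) 2) :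
    functional (S * T) p = functional S (p.1, ampl T.toCLM p.2) := rfl

variable [CompleteSpace H]

theorem functional_mul_left (S T : WeakStarB H)
    (p : lp (fun _ : ℕ => H) 2 × lp (fun _ : ℕ => H) 2) :
    functional (S * T) p =
      functional T (ampl (ContinuousLinearMap.adjoint S.toCLM) p.1, p.2) :=
  tsum_congr fun n => (ContinuousLinearMap.adjoint_inner_left S.toCLM
    (T.toCLM (p.2 n)) (p.1 n)).symm

theorem functional_star (T : WeakStarB H) (p : lp (fun _ : ℕ => H) 2 × lp (fun _ : ℕ => H) 2) :
    functional (star T) p = star (functional T (p.2, p.1)) := by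
  rw [functional, functional, tsum_star]
  refine tsum_congr fun n => ?_
  refine (ContinuousLinearMap.adjoint_inner_right T.toCLM (p.1 n) (p.2 n)).trans ?_
  exact (inner_conj_symm _ _).symm

instance : IsSemitopologicalSemiring (WeakStarB H) where
  continuous_add := continuous_of_functional fun p => by
    simp only [functional_add]
    exact ((continuous_functional p).comp continuous_fst).add
      ((continuous_functional p).comp continuous_snd)
  continuous_const_mul {S} := continuous_of_functional fun p => by
    simp only [functional_mul_left]
    exact continuous_functional _
  continuous_mul_const {S} := continuous_of_functional fun p => by
    simp only [functional_mul_right]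
    exact continuous_functional _

instance : ContinuousStar (WeakStarB H) where
  continuous_star := continuous_of_functional fun p => by
    simp only [functional_star]
    exact (continuous_functional _).star

end WeakStarB

end BoundedOperators

/-! ### Weak* tensor products and their equivalence -/

section WeakStarTensor

variable {M N : Type*}
  [Ring M] [StarRing M] [Algebra ℂ M] [StarModule ℂ M] [TopologicalSpace M]
  [Ring N] [StarRing N] [Algebra ℂ N] [StarModule ℂ N] [TopologicalSpace N]
  {H K : Type*} [NormedAddCommGroup H] [InnerProductSpace ℂ H] [CompleteSpace H]
  [NormedAddCommGroup K] [InnerProductSpace ℂ K] [CompleteSpace K]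

/-- Let `M` and `N` be von Neumann algebras, regarded as `*`-algebras with their weak* topologies.
A `*`-representation `α` of the algebraic tensor product `M ⊙ N` on a Hilbert space `H` defines a
weak* tensor product of `M` and `N` if it is injective and its restrictions `a ↦ α (a ⊗ 1)` and
`b ↦ α (1 ⊗ b)` are weak* homeomorphisms onto their ranges. -/
structure IsWeakStarTensorRep (α : M ⊗[ℂ] N →⋆ₐ[ℂ] (H →L[ℂ] H)) : Prop where
  injective : Function.Injective α
  isEmbedding_left : IsEmbedding fun a : M => WeakStarB.of H (α (a ⊗ₜ[ℂ] (1 : N)))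
  isEmbedding_right : IsEmbedding fun b : N => WeakStarB.of H (α ((1 : M) ⊗ₜ[ℂ] b))

/-- The weak* closure of `α (M ⊙ N)` in `B(H)`. -/
def weakStarTensor (α : M ⊗[ℂ] N →⋆ₐ[ℂ] (H →L[ℂ] H)) : StarSubalgebra ℂ (WeakStarB H) :=
  ((WeakStarB.of H).comp α).range.topologicalClosure

/-- The canonical map from `M ⊙ N` to the weak* closure of `α (M ⊙ N)`. -/
def toWeakStarTensor (α : M ⊗[ℂ] N →⋆ₐ[ℂ] (H →L[ℂ] H)) (u : M ⊗[ℂ] N) : weakStarTensor α :=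
  ⟨WeakStarB.of H (α u), StarSubalgebra.le_topologicalClosure _ ⟨u, rfl⟩⟩

/-- Two weak* tensor products of `M` and `N` are equivalent if `α (a ⊗ b) ↦ β (a ⊗ b)` extends to a
`*`-isomorphism of the weak* closure of `α (M ⊙ N)` onto that of `β (M ⊙ N)`. (A `*`-isomorphism
between von Neumann algebras is automatically normal.) -/
def WeakStarTensorEquiv (α : M ⊗[ℂ] N →⋆ₐ[ℂ] (H →L[ℂ] H)) (β : M ⊗[ℂ] N →⋆ₐ[ℂ] (K →L[ℂ] K)) :
    Prop :=
  ∃ e : weakStarTensor α ≃⋆ₐ[ℂ] weakStarTensor β,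
    ∀ (a : M) (b : N), e (toWeakStarTensor α (a ⊗ₜ[ℂ] b)) = toWeakStarTensor β (a ⊗ₜ[ℂ] b)

end WeakStarTensor

/-! ### Hilbert space direct sums of representations -/

section DirectSum

variable {A ι : Type*} [Semiring A] [Algebra ℂ A] [StarRing A] {H : ι → Type*}
  [∀ i, NormedAddCommGroup (H i)] [∀ i, InnerProductSpace ℂ (H i)] [∀ i, CompleteSpace (H i)]

/-- The direct sum `⊕ᵢ πᵢ` of a family of `*`-representations of `A` with `supᵢ ‖πᵢ(a)‖ < ∞` for
every `a`, acting componentwise on the Hilbert space `⊕ᵢ Hᵢ`. -/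
def directSumRep (π : ∀ i, A →⋆ₐ[ℂ] (H i →L[ℂ] H i)) (hπ : ∀ a, ∃ C : ℝ, ∀ i, ‖π i a‖ ≤ C) :
    A →⋆ₐ[ℂ] (lp H 2 →L[ℂ] lp H 2) :=
  have hC (a : A) : ∃ C : ℝ, 0 ≤ C ∧ ∀ i, ‖π i a‖ ≤ C :=
    (hπ a).elim fun C h => ⟨max C 0, le_max_right _ _, fun i => (h i).trans (le_max_left _ _)⟩
  let D (a : A) : lp H 2 →L[ℂ] lp H 2 :=
    lp.mapCLM 2 (fun i => π i a) (hC a).choose_spec.1 (hC a).choose_spec.2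
  have hD (a : A) (ξ : lp H 2) (i : ι) : D a ξ i = π i a (ξ i) := rfl
  have hext {S T : lp H 2 →L[ℂ] lp H 2} (h : ∀ ξ i, S ξ i = T ξ i) : S = T :=
    ContinuousLinearMap.ext fun ξ => lp.ext (funext fun i => h ξ i)
  { toFun := D
    map_one' := hext fun ξ i => by rw [hD, map_one]; rfl
    map_mul' := fun a b => hext fun ξ i => by rw [hD, map_mul]; rfl
    map_zero' := hext fun ξ i => by rw [hD, map_zero]; rfl
    map_add' := fun a b => hext fun ξ i => by rw [hD, map_add]; rfl
    commutes' := fun c => hext fun ξ i => by rw [hD, AlgHomClass.commutes]; rfl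
    map_star' := fun a => by
      change D (star a) = star (D a)
      rw [ContinuousLinearMap.star_eq_adjoint, ContinuousLinearMap.eq_adjoint_iff]
      intro ξ η
      rw [lp.inner_eq_tsum, lp.inner_eq_tsum]
      refine tsum_congr fun i => ?_
      rw [hD, hD, map_star, ContinuousLinearMap.star_eq_adjoint,
        ContinuousLinearMap.adjoint_inner_left] }

theorem directSumRep_apply (π : ∀ i, A →⋆ₐ[ℂ] (H i →L[ℂ] H i))
    (hπ : ∀ a, ∃ C : ℝ, ∀ i, ‖π i a‖ ≤ C) (a : A) (ξ : lp H 2) (i : ι) :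
    directSumRep π hπ a ξ i = π i a (ξ i) := rfl

end DirectSum

/-! ### The representations of `L^∞(ℝ) ⊙ L^∞(ℝ)` -/

section Line

/-- `L^∞(ℝ)` with respect to Lebesgue measure. -/
abbrev LInftyReal : Type := LInfty (volume : Measure ℝ)

/-- A measure on `ℝ × ℝ` has absolutely continuous marginals if the pullbacks of Lebesgue null sets
along both coordinate projections are null sets. -/
structure HasACMarginals (μ : Measure (ℝ × ℝ)) : Prop where
  fst : Measure.QuasiMeasurePreserving (Prod.fst : ℝ × ℝ → ℝ) μ volume
  snd : Measure.QuasiMeasurePreserving (Prod.snd : ℝ × ℝ → ℝ) μ volume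

/-- The `*`-homomorphism `L^∞(ℝ) ⊙ L^∞(ℝ) → L^∞(ℝ × ℝ, μ)` which sends `f ⊗ g` to the class of the
function `(s, t) ↦ f(s) g(t)`. -/
def tensorToLInfty (μ : Measure (ℝ × ℝ)) (h : HasACMarginals μ) :
    LInftyReal ⊗[ℂ] LInftyReal →⋆ₐ[ℂ] LInfty μ :=
  let P := Algebra.TensorProduct.productMap (LInfty.comp Prod.fst h.fst).toAlgHom
    (LInfty.comp Prod.snd h.snd).toAlgHom
  have hP (f g : LInftyReal) : P (f ⊗ₜ[ℂ] g) =
      LInfty.comp Prod.fst h.fst f * LInfty.comp Prod.snd h.snd g := rfl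
  { P with
    map_star' := fun u => by
      change P (star u) = star (P u)
      induction u with
      | zero => rw [star_zero, map_zero, star_zero]
      | tmul f g => rw [TensorProduct.star_tmul, hP, hP, map_star, map_star, star_mul']
      | add u v hu hv => rw [star_add, map_add, map_add, hu, hv, star_add] }

theorem tensorToLInfty_tmul (μ : Measure (ℝ × ℝ)) (h : HasACMarginals μ) (f g : LInftyReal) :
    tensorToLInfty μ h (f ⊗ₜ[ℂ] g) =
      LInfty.comp Prod.fst h.fst f * LInfty.comp Prod.snd h.snd g := rfl

/-- The representation of `L^∞(ℝ) ⊙ L^∞(ℝ)` on `L^2(ℝ × ℝ, μ)` for which `f ⊗ g` acts as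
multiplication by the function `(s, t) ↦ f(s) g(t)`. -/
def tensorMulRep (μ : Measure (ℝ × ℝ)) (h : HasACMarginals μ) :
    LInftyReal ⊗[ℂ] LInftyReal →⋆ₐ[ℂ] (Lp ℂ 2 μ →L[ℂ] Lp ℂ 2 μ) :=
  (LInfty.mulRep μ).comp (tensorToLInfty μ h)

/-- The shifted diagonal measure `μ_x` on `ℝ × ℝ`, with `∫ f dμ_x = ∫ f(y, x + y) dy`. -/
def shiftedDiagonal (x : ℝ) : Measure (ℝ × ℝ) := volume.map fun y : ℝ => (y, x + y)

theorem hasACMarginals_shiftedDiagonal (x : ℝ) : HasACMarginals (shiftedDiagonal x) := by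
  have hm : Measurable fun y : ℝ => (y, x + y) := by fun_prop
  refine ⟨⟨measurable_fst, ?_⟩, ⟨measurable_snd, ?_⟩⟩
  · rw [shiftedDiagonal, Measure.map_map measurable_fst hm]
    exact (Measure.map_id (μ := (volume : Measure ℝ))).absolutelyContinuous
  · rw [shiftedDiagonal, Measure.map_map measurable_snd hm]
    exact (map_add_left_eq_self (volume : Measure ℝ) x).absolutelyContinuous

theorem hasACMarginals_volume : HasACMarginals (volume : Measure (ℝ × ℝ)) :=
  ⟨Measure.quasiMeasurePreserving_fst, Measure.quasiMeasurePreserving_snd⟩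

/-- The representation `π_x` of `L^∞(ℝ) ⊙ L^∞(ℝ)` on `L^2(ℝ × ℝ, μ_x)`. -/
def piRep (x : ℝ) : LInftyReal ⊗[ℂ] LInftyReal →⋆ₐ[ℂ]
    (Lp ℂ 2 (shiftedDiagonal x) →L[ℂ] Lp ℂ 2 (shiftedDiagonal x)) :=
  tensorMulRep (shiftedDiagonal x) (hasACMarginals_shiftedDiagonal x)

/-- The canonical inclusion `σ` of `L^∞(ℝ) ⊙ L^∞(ℝ)` in `L^∞(ℝ × ℝ)`, acting on `L^2(ℝ × ℝ)`. -/
def sigmaRep : LInftyReal ⊗[ℂ] LInftyReal →⋆ₐ[ℂ]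
    (Lp ℂ 2 (volume : Measure (ℝ × ℝ)) →L[ℂ] Lp ℂ 2 (volume : Measure (ℝ × ℝ))) :=
  tensorMulRep volume hasACMarginals_volume

/-- The measures of the summands of `⊕_{x ∈ S} π_x ⊕ σ`, where the index `none` stands for `σ`. -/
def summandMeasure (S : Set ℝ) : Option S → Measure (ℝ × ℝ)
  | some x => shiftedDiagonal x
  | none => volume

/-- The summands of `⊕_{x ∈ S} π_x ⊕ σ`. -/
def summandRep (S : Set ℝ) : (i : Option S) → LInftyReal ⊗[ℂ] LInftyReal →⋆ₐ[ℂ]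
    (Lp ℂ 2 (summandMeasure S i) →L[ℂ] Lp ℂ 2 (summandMeasure S i))
  | some x => piRep x
  | none => sigmaRep

theorem exists_norm_tensorMulRep_le (u : LInftyReal ⊗[ℂ] LInftyReal) :
    ∃ C : ℝ, ∀ (μ : Measure (ℝ × ℝ)) (h : HasACMarginals μ), ‖tensorMulRep μ h u‖ ≤ C := by
  induction u with
  | zero => exact ⟨0, fun μ h => by rw [map_zero, norm_zero]⟩
  | tmul f g =>
    refine ⟨lpNorm (fun x => f x) ∞ volume * lpNorm (fun x => g x) ∞ volume, fun μ h => ?_⟩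
    change ‖LInfty.mulRep μ (LInfty.comp Prod.fst h.fst f * LInfty.comp Prod.snd h.snd g)‖ ≤ _
    rw [map_mul]
    exact (norm_mul_le _ _).trans (mul_le_mul (LInfty.norm_mulRep_comp_le _ _ _)
      (LInfty.norm_mulRep_comp_le _ _ _) (norm_nonneg _) lpNorm_nonneg)
  | add u v hu hv =>
    obtain ⟨C, hC⟩ := hu
    obtain ⟨D, hD⟩ := hv
    refine ⟨C + D, fun μ h => ?_⟩
    rw [map_add]
    exact (norm_add_le _ _).trans (add_le_add (hC μ h) (hD μ h))

theorem exists_norm_summandRep_le (S : Set ℝ) (u : LInftyReal ⊗[ℂ] LInftyReal) :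
    ∃ C : ℝ, ∀ i, ‖summandRep S i u‖ ≤ C :=
  (exists_norm_tensorMulRep_le u).imp fun _ hC i =>
    match i with
    | some _ => hC _ _
    | none => hC _ _

/-- The Hilbert space `⊕_{x ∈ S} L^2(μ_x) ⊕ L^2(ℝ × ℝ)`. -/
abbrev AlphaSpace (S : Set ℝ) : Type := lp (fun i : Option S => Lp ℂ 2 (summandMeasure S i)) 2

/-- The representation `α_S = ⊕_{x ∈ S} π_x ⊕ σ` of `L^∞(ℝ) ⊙ L^∞(ℝ)`. -/
def alphaRep (S : Set ℝ) :
    LInftyReal ⊗[ℂ] LInftyReal →⋆ₐ[ℂ] (AlphaSpace S →L[ℂ] AlphaSpace S) :=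
  directSumRep (summandRep S) (exists_norm_summandRep_le S)

end Line

end

/-!
Every operator in sight acts on a direct sum `⨁ᵢ L²(μᵢ)` by multiplication with a bounded function
on each summand (`IsDiagMul`), so statements about weak* limits become statements about measures.

*The representation `α_S` defines a weak* tensor product.* It is injective because its summand `σ`
is, by Fubini's theorem and linear independence (`tensorToLInfty_volume_injective`). For the
restriction to the first factor, let `ζ` be a square summable sequence of vectors. The functional
`T ↦ ∑ₙ ⟨ζₙ, T ζₙ⟩` takes at `α_S (f ⊗ 1)` the value `∫ f dρ`, where `ρ` is the image under the
first projection of the finite measure `∑ₙ ∑ᵢ |ζₙᵢ|² μᵢ` (`IsDiagMul.functional_comp`). As the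
marginals of the `μᵢ` are absolutely continuous, `ρ` has an integrable density, which together with
polarisation gives continuity. Conversely every integrable function on the line arises from a pair
of vectors in `L²(ℝ × ℝ)` supported in a strip of width one (`exists_functional_eq_integral`), so
the restriction is an embedding. The second factor is treated in the same way.

*Different sets give nonequivalent completions.* Let `x ∈ S \ T` and let `D` be the segment
`{(s, x + s) : 0 ≤ s < 1}`. The indicator functions of the `k + 1` squares of side `1 / (k + 1)`
along `D` are elements `q k` of `L^∞(ℝ) ⊙ L^∞(ℝ)` which converge pointwise to the indicator
function of `D`. By dominated convergence `α_S (q k)` tends weak* to the projection `p` of `D`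
(`tendsto_alphaRep_squaresTensor`). It is nonzero since `μ_x D = 1`, it lies in the weak* closure,
and `p * α_S (q k) = p` for all `k`. On the other side, `D` is null for Lebesgue measure and for
`μ_y` with `y ≠ x`, so that `α_T (q k)` tends to `0`. A `*`-isomorphism `e` extending
`α_S (a ⊗ b) ↦ α_T (a ⊗ b)` would satisfy `e p = e p * α_T (q k)` for all `k`, hence `e p = 0`,
which is absurd. This argument does not involve the normality of `e`.
-/

noncomputable section

open Filter

/-! ### Weak* convergence of multiplication operators -/

theorem LInfty.inner_mulRep {X : Type*} [MeasurableSpace X] {μ : Measure X} (f : LInfty μ)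
    (ξ η : Lp ℂ 2 μ) :
    ⟪ξ, LInfty.mulRep μ f η⟫_ℂ = ∫ x, f x * (η x * star (ξ x)) ∂μ := by
  rw [L2.inner_def]
  refine integral_congr_ae ?_
  filter_upwards [LInfty.mulRep_apply f η] with x hx
  rw [hx, RCLike.inner_apply, RCLike.star_def]
  ring

theorem LInfty.norm_mulRep_apply_le {X : Type*} [MeasurableSpace X] {μ : Measure X} (f : LInfty μ)
    (hf : ∀ᵐ x ∂μ, ‖f x‖ ≤ 1) (ξ : Lp ℂ 2 μ) : ‖LInfty.mulRep μ f ξ‖ ≤ ‖ξ‖ := by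
  refine Lp.norm_le_norm_of_ae_le ?_
  filter_upwards [LInfty.mulRep_apply f ξ, hf] with x h1 h2
  rw [h1, norm_mul]
  exact mul_le_of_le_one_left (norm_nonneg _) h2

theorem LInfty.tendsto_inner_mulRep {X : Type*} [MeasurableSpace X] {μ : Measure X}
    {f : ℕ → LInfty μ} {g : LInfty μ} (hf : ∀ k, ∀ᵐ x ∂μ, ‖f k x‖ ≤ 1)
    (hfg : ∀ᵐ x ∂μ, Tendsto (fun k => f k x) atTop (𝓝 (g x))) (ξ η : Lp ℂ 2 μ) :
    Tendsto (fun k => ⟪ξ, LInfty.mulRep μ (f k) η⟫_ℂ) atTop (𝓝 ⟪ξ, LInfty.mulRep μ g η⟫_ℂ) := by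
  simp only [LInfty.inner_mulRep]
  have hint : Integrable (fun x => η x * star (ξ x)) μ := by
    simpa only [RCLike.inner_apply, RCLike.star_def] using L2.integrable_inner (𝕜 := ℂ) ξ η
  refine tendsto_integral_of_dominated_convergence (fun x => ‖η x * star (ξ x)‖)
    (fun k => (f k).memLp.1.mul hint.1) hint.norm (fun k => ?_) ?_
  · filter_upwards [hf k] with x hx
    rw [norm_mul]
    exact mul_le_of_le_one_left (norm_nonneg _) hx
  · filter_upwards [hfg] with x hx
    exact hx.mul_const _

/-- Dominated convergence for inner products in a Hilbert space direct sum. -/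
theorem lp.tendsto_inner_of_dominated {ι : Type*} {E : ι → Type*}
    [∀ i, NormedAddCommGroup (E i)] [∀ i, InnerProductSpace ℂ (E i)]
    {ξ η ζ : lp E 2} {u : ℕ → lp E 2} (hu : ∀ k i, ‖u k i‖ ≤ ‖η i‖)
    (hlim : ∀ i, Tendsto (fun k => ⟪ξ i, u k i⟫_ℂ) atTop (𝓝 ⟪ξ i, ζ i⟫_ℂ)) :
    Tendsto (fun k => ⟪ξ, u k⟫_ℂ) atTop (𝓝 ⟪ξ, ζ⟫_ℂ) := by
  simp only [lp.inner_eq_tsum]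
  refine tendsto_tsum_of_dominated_convergence (bound := fun i => ‖ξ i‖ * ‖η i‖) ?_ hlim ?_
  · exact lp.summable_mul (Real.holderConjugate_iff.2 (by norm_num)) ξ η
  · exact Eventually.of_forall fun k i => (norm_inner_le_norm _ _).trans
      (mul_le_mul_of_nonneg_left (hu k i) (norm_nonneg _))

namespace WeakStarB

variable {H : Type*} [NormedAddCommGroup H] [InnerProductSpace ℂ H]

theorem functional_single [CompleteSpace H] (T : H →L[ℂ] H) (ξ η : H) :
    functional (of H T) (lp.single 2 0 ξ, lp.single 2 0 η) = ⟪ξ, T η⟫_ℂ := by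
  rw [functional_eq, lp.inner_single_left, ampl_apply, lp.single_apply_self]
  rfl

/-- On the unit ball of `B(H)` the weak operator topology is as fine as the weak* topology, stated
for sequences. -/
theorem tendsto_of_tendsto_inner [CompleteSpace H] {T : ℕ → H →L[ℂ] H} {T' : H →L[ℂ] H}
    (hT : ∀ k ξ, ‖T k ξ‖ ≤ ‖ξ‖)
    (hlim : ∀ ξ η, Tendsto (fun k => ⟪ξ, T k η⟫_ℂ) atTop (𝓝 ⟪ξ, T' η⟫_ℂ)) :
    Tendsto (fun k => of H (T k)) atTop (𝓝 (of H T')) := by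
  rw [nhds_induced, tendsto_comap_iff, tendsto_pi_nhds]
  intro p
  simp only [Function.comp_apply, functional_eq]
  exact lp.tendsto_inner_of_dominated (η := p.2) (fun k n => hT k _) (fun n => hlim _ _)

instance [CompleteSpace H] : T2Space (WeakStarB H) := by
  refine T2Space.of_injective_continuous (f := functional) (fun S T h => ?_) continuous_induced_dom
  refine ContinuousLinearMap.ext (f := S.toCLM) (g := T.toCLM) fun η => ext_inner_left ℂ fun ξ => ?_
  have := congrFun h (lp.single 2 0 ξ, lp.single 2 0 η)
  exact (functional_single S.toCLM ξ η).symm.trans (this.trans (functional_single T.toCLM ξ η))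

end WeakStarB

section Diagonal

variable {X ι : Type*} [MeasurableSpace X] {μ : ι → Measure X}

/-- The operator `T` on `⨁ᵢ L²(μᵢ)` acts on the `i`-th summand as multiplication by `F i`. -/
def IsDiagMul (T : lp (fun i => Lp ℂ 2 (μ i)) 2 →L[ℂ] lp (fun i => Lp ℂ 2 (μ i)) 2)
    (F : ∀ i, LInfty (μ i)) : Prop :=
  ∀ ξ i, T ξ i = LInfty.mulRep (μ i) (F i) (ξ i)

/-- If the multipliers are bounded by one and converge almost everywhere on every summand, then the
operators converge in the weak* topology, by dominated convergence in each `L²(μᵢ)`, in the direct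
sum, and in the series of a weak* functional. -/
theorem IsDiagMul.tendsto {T : ℕ → lp (fun i => Lp ℂ 2 (μ i)) 2 →L[ℂ] lp (fun i => Lp ℂ 2 (μ i)) 2}
    {T' : lp (fun i => Lp ℂ 2 (μ i)) 2 →L[ℂ] lp (fun i => Lp ℂ 2 (μ i)) 2}
    {F : ℕ → ∀ i, LInfty (μ i)} {F' : ∀ i, LInfty (μ i)}
    (hT : ∀ k, IsDiagMul (T k) (F k)) (hT' : IsDiagMul T' F')
    (hF : ∀ k i, ∀ᵐ x ∂μ i, ‖F k i x‖ ≤ 1)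
    (hlim : ∀ i, ∀ᵐ x ∂μ i, Tendsto (fun k => F k i x) atTop (𝓝 (F' i x))) :
    Tendsto (fun k => WeakStarB.of _ (T k)) atTop (𝓝 (WeakStarB.of _ T')) := by
  have hb (k) (ξ : lp (fun i => Lp ℂ 2 (μ i)) 2) (i : ι) : ‖T k ξ i‖ ≤ ‖ξ i‖ := by
    rw [hT k ξ i]
    exact LInfty.norm_mulRep_apply_le _ (hF k i) _
  refine WeakStarB.tendsto_of_tendsto_inner (fun k ξ => lp.norm_mono two_ne_zero (hb k ξ))
    fun ξ η => lp.tendsto_inner_of_dominated (η := η) (fun k i => hb k η i) fun i => ?_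
  simp only [hT _ η i, hT' η i]
  exact LInfty.tendsto_inner_mulRep (hF · i) (hlim i) _ _

end Diagonal

/-! ### Vector functionals and embeddings of `L^∞` -/

namespace WeakStarB

/-- By polarisation, weak* continuity can be tested on the functionals `T ↦ ∑ₙ ⟨ζₙ, T ζₙ⟩`. -/
theorem continuous_of_functional_diag {H Z : Type*} [NormedAddCommGroup H] [InnerProductSpace ℂ H]
    [TopologicalSpace Z] {F : Z → WeakStarB H}
    (hF : ∀ ζ, Continuous fun z => functional (F z) (ζ, ζ)) : Continuous F := by
  refine continuous_of_functional fun p => ?_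
  have hF' (ζ : lp (fun _ : ℕ => H) 2) : Continuous fun z => ⟪ampl (F z).toCLM ζ, ζ⟫_ℂ := by
    have := (hF ζ).star
    simp only [functional_eq, RCLike.star_def, inner_conj_symm] at this
    exact this
  have key (z : Z) := congrArg star
    (inner_map_polarization (ampl (F z).toCLM : _ →ₗ[ℂ] lp (fun _ : ℕ => H) 2) p.1 p.2)
  simp only [ContinuousLinearMap.coe_coe, RCLike.star_def, inner_conj_symm] at key
  simp only [functional_eq, key]
  refine Complex.continuous_conj.comp ?_
  have h1 := hF' (p.1 + p.2)
  have h2 := hF' (p.1 - p.2)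
  have h3 := hF' (p.1 + Complex.I • p.2)
  have h4 := hF' (p.1 - Complex.I • p.2)
  fun_prop

end WeakStarB

section Diagonal

variable {X Y ι : Type*} [MeasurableSpace X] [MeasurableSpace Y] {μ : ι → Measure X}
  {ν : Measure Y}

/-- The positive measure `∑ₙ ∑ᵢ |ζₙᵢ|² μᵢ` attached to a square summable sequence `ζ` in
`⨁ᵢ L²(μᵢ)`. -/
def vectorMeasure (ζ : lp (fun _ : ℕ => lp (fun i => Lp ℂ 2 (μ i)) 2) 2) : Measure X :=
  Measure.sum fun p : ℕ × ι => (μ p.2).withDensity fun x => ‖ζ p.1 p.2 x‖ₑ ^ 2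

theorem lp.tsum_enorm_sq {κ : Type*} {E : κ → Type*} [∀ i, NormedAddCommGroup (E i)]
    (ζ : lp E 2) : ∑' i, ‖ζ i‖ₑ ^ 2 = ‖ζ‖ₑ ^ 2 := by
  have h := lp.hasSum_norm (p := 2) (by norm_num) ζ
  simp only [ENNReal.toReal_ofNat, Real.rpow_two] at h
  have h2 := h.tsum_eq
  simp only [← ofReal_norm, ← ENNReal.ofReal_pow (norm_nonneg _)]
  rw [← h2, ENNReal.ofReal_tsum_of_nonneg (fun _ => by positivity) h.summable]

theorem vectorMeasure_univ (ζ : lp (fun _ : ℕ => lp (fun i => Lp ℂ 2 (μ i)) 2) 2) :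
    vectorMeasure ζ Set.univ = ‖ζ‖ₑ ^ 2 := by
  rw [vectorMeasure, Measure.sum_apply _ MeasurableSet.univ, ENNReal.tsum_prod',
    ← lp.tsum_enorm_sq]
  refine tsum_congr fun n => ?_
  rw [← lp.tsum_enorm_sq]
  refine tsum_congr fun i => ?_
  rw [withDensity_apply _ MeasurableSet.univ, Measure.restrict_univ, Lp.enorm_def,
    eLpNorm_eq_lintegral_rpow_enorm_toReal two_ne_zero ENNReal.ofNat_ne_top]
  simp only [ENNReal.toReal_ofNat, ENNReal.rpow_two, one_div]
  rw [← ENNReal.rpow_two, ← ENNReal.rpow_mul]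
  norm_num

instance (ζ : lp (fun _ : ℕ => lp (fun i => Lp ℂ 2 (μ i)) 2) 2) :
    IsFiniteMeasure (vectorMeasure ζ) :=
  ⟨by rw [vectorMeasure_univ]; exact ENNReal.pow_lt_top enorm_lt_top⟩

theorem map_vectorMeasure_absolutelyContinuous {φ : X → Y}
    (hm : Measurable φ) (hφ : ∀ i, Measure.QuasiMeasurePreserving φ (μ i) ν)
    (ζ : lp (fun _ : ℕ => lp (fun i => Lp ℂ 2 (μ i)) 2) 2) : (vectorMeasure ζ).map φ ≪ ν := by
  refine Measure.AbsolutelyContinuous.mk fun s hs h0 => ?_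
  rw [Measure.map_apply hm hs, vectorMeasure, Measure.sum_apply _ (hm hs),
    ENNReal.tsum_eq_zero]
  exact fun p => withDensity_absolutelyContinuous _ _ ((hφ p.2).preimage_null h0)

/-- The vector functional of `ζ` at the operator of multiplication by `f ∘ φ` is integration of `f`
against the image of `vectorMeasure ζ` under `φ`. -/
theorem IsDiagMul.functional_comp {φ : X → Y} (hm : Measurable φ)
    (hφ : ∀ i, Measure.QuasiMeasurePreserving φ (μ i) ν) {f : LInfty ν}
    {T : lp (fun i => Lp ℂ 2 (μ i)) 2 →L[ℂ] lp (fun i => Lp ℂ 2 (μ i)) 2}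
    (hT : IsDiagMul T fun i => LInfty.comp φ (hφ i) f)
    (ζ : lp (fun _ : ℕ => lp (fun i => Lp ℂ 2 (μ i)) 2) 2) :
    WeakStarB.functional (WeakStarB.of _ T) (ζ, ζ) = ∫ y, f y ∂(vectorMeasure ζ).map φ := by
  have hac := map_vectorMeasure_absolutelyContinuous hm hφ ζ
  have hsm : StronglyMeasurable (fun y => f y) := Lp.stronglyMeasurable f.toLp
  have hint : Integrable (fun y => f y) ((vectorMeasure ζ).map φ) :=
    .of_bound hsm.aestronglyMeasurable (lpNorm (fun y => f y) ∞ ν)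
      (hac (ae_le_lpNorm_exponent_top f.memLp))
  have hint' : Integrable (fun x => f (φ x)) (vectorMeasure ζ) :=
    (integrable_map_measure hsm.aestronglyMeasurable hm.aemeasurable).1 hint
  rw [integral_map hm.aemeasurable hsm.aestronglyMeasurable]
  have hsum := hasSum_integral_measure hint'
  rw [vectorMeasure, ← hsum.tsum_eq, hsum.summable.tsum_prod]
  refine tsum_congr fun n => ?_
  refine (lp.inner_eq_tsum (𝕜 := ℂ) (ζ n) (T (ζ n))).trans (tsum_congr fun i => ?_)
  have hζ : Measurable fun x => ‖ζ n i x‖ₑ ^ 2 :=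
    (Lp.stronglyMeasurable (ζ n i)).measurable.enorm.pow_const 2
  rw [hT, LInfty.inner_mulRep, integral_withDensity_eq_integral_toReal_smul hζ
    (Eventually.of_forall fun x => ENNReal.pow_lt_top enorm_lt_top)]
  refine integral_congr_ae ?_
  filter_upwards [LInfty.comp_apply φ (hφ i) f] with x hx
  rw [hx, RCLike.star_def, Complex.mul_conj', ENNReal.toReal_pow, toReal_enorm,
    Complex.real_smul, mul_comm, Complex.ofReal_pow]

theorem LInfty.continuous_integral_mul {g : Y → ℂ} (hg : Integrable g ν) :
    Continuous fun f : LInfty ν => ∫ y, f y * g y ∂ν := by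
  have h : Continuous fun f : LInfty ν => ∫ y, f y * (hg.toL1 g) y ∂ν :=
    (continuous_apply (hg.toL1 g)).comp
      (continuous_induced_dom (f := fun (f : LInfty ν) (h : Lp ℂ 1 ν) => ∫ y, f y * h y ∂ν))
  refine h.congr fun f => integral_congr_ae ?_
  filter_upwards [hg.coeFn_toL1] with y hy
  rw [hy]

/-- The functional `f ↦ ∫ f dρ` is weak* continuous for `ρ ≪ ν`, since `ρ` has an integrable
density. -/
theorem LInfty.continuous_integral [SigmaFinite ν] {ρ : Measure Y} [IsFiniteMeasure ρ]
    (hρ : ρ ≪ ν) : Continuous fun f : LInfty ν => ∫ y, f y ∂ρ := by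
  refine (LInfty.continuous_integral_mul (ν := ν) (g := fun y => ((ρ.rnDeriv ν y).toReal : ℂ))
    Measure.integrable_toReal_rnDeriv.ofReal).congr fun f => ?_
  rw [← integral_rnDeriv_smul hρ]
  simp only [Complex.real_smul, mul_comm]

/-- Every integrable function `g` on `Y` is realised by a vector functional on `⨁ᵢ L²(μᵢ)`, as soon
as `ν` is the image of some `μᵢ` restricted to a measurable set. -/
theorem exists_functional_eq_integral {φ : X → Y} (hm : Measurable φ)
    (hφ : ∀ i, Measure.QuasiMeasurePreserving φ (μ i) ν) (i : ι) {W : Set X} (hW : MeasurableSet W)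
    (hWν : ((μ i).restrict W).map φ = ν) (g : Lp ℂ 1 ν) :
    ∃ p : lp (fun _ : ℕ => lp (fun i => Lp ℂ 2 (μ i)) 2) 2 ×
        lp (fun _ : ℕ => lp (fun i => Lp ℂ 2 (μ i)) 2) 2,
      ∀ (f : LInfty ν) (T : lp (fun i => Lp ℂ 2 (μ i)) 2 →L[ℂ] lp (fun i => Lp ℂ 2 (μ i)) 2),
        IsDiagMul T (fun i => LInfty.comp φ (hφ i) f) →
        WeakStarB.functional (WeakStarB.of _ T) p = ∫ y, f y * g y ∂ν := by
  classical
  -- `g = b * a` with `a = |g|^{1/2}` and `|b| = |g|^{1/2}`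
  let a : Y → ℂ := fun y => (√‖g y‖ : ℝ)
  let b : Y → ℂ := fun y => g y / a y
  have hgm : Measurable (fun y => g y) := (Lp.stronglyMeasurable g).measurable
  have ham : Measurable a := by fun_prop
  have hbm : Measurable b := hgm.div ham
  have hna (y) : ‖a y‖ = √‖g y‖ := by
    rw [Complex.norm_real, Real.norm_of_nonneg (Real.sqrt_nonneg _)]
  have ha : MemLp a 2 ν := by
    rw [memLp_two_iff_integrable_sq_norm ham.aestronglyMeasurable]
    refine (L1.integrable_coeFn g).norm.congr (Eventually.of_forall fun y => ?_)
    simp only [hna, Real.sq_sqrt (norm_nonneg _)]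
  have hb : MemLp b 2 ν := ha.mono hbm.aestronglyMeasurable <| Eventually.of_forall fun y => by
    rw [norm_div, hna, Real.div_sqrt]
  have hab (y) : b y * star (a y) = g y := by
    have hs : star (a y) = a y := Complex.conj_ofReal _
    rw [hs]
    by_cases h : g y = 0
    · simp [b, h]
    · exact div_mul_cancel₀ _ fun h' => h <| by
        have := hna y
        rw [h', norm_zero, eq_comm, Real.sqrt_eq_zero (norm_nonneg _), norm_eq_zero] at this
        exact this
  have hmp : MeasurePreserving φ ((μ i).restrict W) ν := ⟨hm, hWν⟩
  have hmem {c : Y → ℂ} (hc : MemLp c 2 ν) : MemLp (W.indicator (c ∘ φ)) 2 (μ i) :=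
    (memLp_indicator_iff_restrict hW).2 (hc.comp_measurePreserving hmp)
  refine ⟨(lp.single 2 0 (lp.single 2 i ((hmem ha).toLp _)),
    lp.single 2 0 (lp.single 2 i ((hmem hb).toLp _))), fun f T hT => ?_⟩
  have hfg : AEStronglyMeasurable (fun y => f y * g y) (((μ i).restrict W).map φ) :=
    ((Lp.stronglyMeasurable f.toLp).mul (Lp.stronglyMeasurable g)).aestronglyMeasurable
  rw [WeakStarB.functional_single, lp.inner_single_left, hT, lp.single_apply_self,
    LInfty.inner_mulRep]
  have hint := integral_map hm.aemeasurable hfg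
  rw [hWν, ← integral_indicator hW] at hint
  rw [hint]
  refine integral_congr_ae ?_
  filter_upwards [LInfty.comp_apply φ (hφ i) f, (hmem ha).coeFn_toLp, (hmem hb).coeFn_toLp]
    with x h1 h2 h3
  rw [h1, h2, h3]
  by_cases hx : x ∈ W
  · simp only [Set.indicator_of_mem hx, Function.comp_apply, hab]
  · simp only [Set.indicator_of_notMem hx, zero_mul, mul_zero]

/-- Multiplication by `f ∘ φ` on `⨁ᵢ L²(μᵢ)` recovers the weak* topology of `L^∞(ν)`: it is continuous
since vector functionals pull back to integrals against measures absolutely continuous with respect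
to `ν`, and every weak* continuous functional on `L^∞(ν)` is such a pullback. -/
theorem isInducing_of_isDiagMul [SigmaFinite ν] {φ : X → Y} (hm : Measurable φ)
    (hφ : ∀ i, Measure.QuasiMeasurePreserving φ (μ i) ν) (i : ι) {W : Set X} (hW : MeasurableSet W)
    (hWν : ((μ i).restrict W).map φ = ν)
    {F : LInfty ν → lp (fun i => Lp ℂ 2 (μ i)) 2 →L[ℂ] lp (fun i => Lp ℂ 2 (μ i)) 2}
    (hF : ∀ f, IsDiagMul (F f) fun i => LInfty.comp φ (hφ i) f) :
    IsInducing fun f => WeakStarB.of _ (F f) := by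
  refine ⟨le_antisymm ?_ ?_⟩
  · refine continuous_iff_le_induced.1 (WeakStarB.continuous_of_functional_diag fun ζ => ?_)
    have (f : LInfty ν) := (hF f).functional_comp hm hφ ζ
    simp only [this]
    exact LInfty.continuous_integral (map_vectorMeasure_absolutelyContinuous hm hφ ζ)
  · choose p hp using exists_functional_eq_integral hm hφ i hW hWν
    have hc : Continuous fun (T : WeakStarB (lp (fun i => Lp ℂ 2 (μ i)) 2)) (g : Lp ℂ 1 ν) =>
        WeakStarB.functional T (p g) :=
      continuous_pi fun g => WeakStarB.continuous_functional (p g)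
    refine (induced_mono (continuous_iff_le_induced.1 hc)).trans_eq ?_
    rw [induced_compose]
    exact congrArg (TopologicalSpace.induced · inferInstance)
      (funext fun f => funext fun g => hp g f _ (hF f))

end Diagonal

/-! ### The representations define weak* tensor products -/

theorem LInfty.coe_finset_sum {X κ : Type*} [MeasurableSpace X] {μ : Measure X} (s : Finset κ)
    (f : κ → LInfty μ) : (∑ j ∈ s, f j : LInfty μ) =ᵐ[μ] fun x => ∑ j ∈ s, f j x := by
  classical
  induction s using Finset.induction_on with
  | empty =>
    simp only [Finset.sum_empty]
    exact coe_zero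
  | insert j s hj ih =>
    rw [Finset.sum_insert hj]
    filter_upwards [coe_add (f j) (∑ j ∈ s, f j), ih] with x h1 h2
    rw [h1, h2, Finset.sum_insert hj]

theorem LInfty.mulRep_injective {X : Type*} [MeasurableSpace X] (μ : Measure X) [SigmaFinite μ] :
    Function.Injective (LInfty.mulRep μ) := by
  refine (injective_iff_map_eq_zero _).2 fun f hf => LInfty.ext ?_
  -- a nowhere vanishing square integrable function
  obtain ⟨g, hpos, hgm, hg⟩ := exists_pos_lintegral_lt_of_sigmaFinite μ (ε := 1) one_ne_zero
  let w : X → ℂ := fun x => (√(g x) : ℝ)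
  have hw : MemLp w 2 μ := by
    rw [memLp_two_iff_integrable_sq_norm (by fun_prop)]
    have hi : Integrable (fun x => ((g x : ℝ≥0∞)).toReal) μ :=
      integrable_toReal_of_lintegral_ne_top (by fun_prop) (hg.trans ENNReal.one_lt_top).ne
    refine hi.congr (Eventually.of_forall fun x => ?_)
    simp only [w, Complex.norm_real, Real.norm_of_nonneg (Real.sqrt_nonneg _),
      Real.sq_sqrt (NNReal.coe_nonneg _), ENNReal.coe_toReal]
  have h0 : LInfty.mulRep μ f (hw.toLp w) = 0 := by rw [hf]; rfl
  filter_upwards [LInfty.mulRep_apply f (hw.toLp w), hw.coeFn_toLp, Lp.coeFn_zero ℂ 2 μ,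
    LInfty.coe_zero (μ := μ)] with x h1 h2 h3 h4
  rw [h0, h3, h2, Pi.zero_apply, eq_comm, mul_eq_zero] at h1
  rw [h4]
  refine h1.resolve_right ?_
  simpa [w, Real.sqrt_eq_zero'] using (hpos x).ne'

instance LInfty.instNontrivial {X : Type*} [MeasurableSpace X] {μ : Measure X} [NeZero μ] :
    Nontrivial (LInfty μ) :=
  ⟨0, 1, fun h => by
    have h0 := LInfty.coe_zero (μ := μ)
    rw [h] at h0
    obtain ⟨x, h1, h2⟩ := (h0.and (LInfty.coe_one (μ := μ))).exists
    exact zero_ne_one (h1.symm.trans h2)⟩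

/-- Injectivity of `L^∞(ℝ) ⊙ L^∞(ℝ) → L^∞(ℝ × ℝ)`: if `∑ⱼ cⱼ(s) bⱼ(t) = 0` almost everywhere with
linearly independent `bⱼ`, then for almost every `s` the vector `∑ⱼ cⱼ(s) bⱼ` of `L^∞(ℝ)` vanishes,
so all `cⱼ(s)` vanish. -/
theorem tensorToLInfty_volume_injective :
    Function.Injective (tensorToLInfty volume hasACMarginals_volume) := by
  refine (injective_iff_map_eq_zero _).2 fun u hu => ?_
  let b := Module.Basis.ofVectorSpace ℂ LInftyReal
  obtain ⟨c, rfl⟩ := TensorProduct.eq_repr_basis_right b u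
  suffices h : ∀ j ∈ c.support, c j = 0 from
    Finset.sum_eq_zero fun j hj => by simp only [h j hj, zero_tmul]
  have hprod : ∀ᵐ p : ℝ × ℝ, ∑ j ∈ c.support, c j p.1 * b j p.2 = 0 := by
    rw [Finsupp.sum, map_sum] at hu
    have hterm (j) : ∀ᵐ p : ℝ × ℝ,
        tensorToLInfty volume hasACMarginals_volume (c j ⊗ₜ b j) p = c j p.1 * b j p.2 := by
      rw [tensorToLInfty_tmul]
      filter_upwards [LInfty.coe_mul (LInfty.comp Prod.fst hasACMarginals_volume.fst (c j))
          (LInfty.comp Prod.snd hasACMarginals_volume.snd (b j)),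
        LInfty.comp_apply Prod.fst hasACMarginals_volume.fst (c j),
        LInfty.comp_apply Prod.snd hasACMarginals_volume.snd (b j)] with p h1 h2 h3
      rw [h1, h2, h3]
    have hall := (Finset.eventually_all c.support).2 fun j _ => hterm j
    filter_upwards [hall, LInfty.coe_finset_sum c.support fun j =>
      tensorToLInfty volume hasACMarginals_volume (c j ⊗ₜ b j),
      LInfty.coe_zero (μ := (volume : Measure (ℝ × ℝ)))] with p h1 h2 h3
    rw [hu, h3] at h2
    rw [h2]
    exact Finset.sum_congr rfl fun j hj => (h1 j hj).symm
  have hfib := Measure.ae_ae_of_ae_prod (μ := (volume : Measure ℝ)) (ν := (volume : Measure ℝ)) hprod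
  intro j hj
  refine LInfty.ext ?_
  filter_upwards [hfib, LInfty.coe_zero (μ := (volume : Measure ℝ))] with s hs h0
  rw [h0]
  refine linearIndependent_iff'.1 b.linearIndependent c.support (fun j => c j s) ?_ j hj
  refine LInfty.ext ?_
  have hall := (Finset.eventually_all c.support).2 fun j _ => LInfty.coe_smul (c j s) (b j)
  filter_upwards [hs, LInfty.coe_finset_sum c.support fun j => c j s • b j, hall,
    LInfty.coe_zero (μ := (volume : Measure ℝ))] with t h1 h2 h3 h4
  rw [h2, h4, ← h1]
  exact Finset.sum_congr rfl fun j hj => h3 j hj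

theorem hasACMarginals_summandMeasure (S : Set ℝ) : ∀ i, HasACMarginals (summandMeasure S i)
  | some x => hasACMarginals_shiftedDiagonal x
  | none => hasACMarginals_volume

theorem isDiagMul_alphaRep (S : Set ℝ) (u : LInftyReal ⊗[ℂ] LInftyReal) :
    IsDiagMul (alphaRep S u) fun i =>
      tensorToLInfty (summandMeasure S i) (hasACMarginals_summandMeasure S i) u := by
  intro ξ i
  cases i <;> rfl

theorem alphaRep_injective (S : Set ℝ) : Function.Injective (alphaRep S) := by
  classical
  refine (injective_iff_map_eq_zero _).2 fun u hu => ?_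
  refine (injective_iff_map_eq_zero _).1 tensorToLInfty_volume_injective u <|
    (injective_iff_map_eq_zero _).1 (LInfty.mulRep_injective volume) _ ?_
  refine ContinuousLinearMap.ext fun ξ => ?_
  let ζ : AlphaSpace S := lp.single 2 none ξ
  have hζ : ζ none = ξ :=
    lp.single_apply_self (E := fun i : Option S => Lp ℂ 2 (summandMeasure S i)) 2 none ξ
  have h := isDiagMul_alphaRep S u ζ none
  rw [hu, hζ] at h
  exact h.symm

theorem map_fst_strip :
    ((volume : Measure (ℝ × ℝ)).restrict (Set.univ ×ˢ Set.Icc 0 1)).map Prod.fst = volume := by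
  rw [Measure.volume_eq_prod, ← Measure.prod_restrict, Measure.map_fst_prod]
  simp

theorem map_snd_strip :
    ((volume : Measure (ℝ × ℝ)).restrict (Set.Icc 0 1 ×ˢ Set.univ)).map Prod.snd = volume := by
  rw [Measure.volume_eq_prod, ← Measure.prod_restrict, Measure.map_snd_prod]
  simp

theorem isWeakStarTensorRep_alphaRep (S : Set ℝ) : IsWeakStarTensorRep (alphaRep S) where
  injective := alphaRep_injective S
  isEmbedding_left := by
    refine ⟨isInducing_of_isDiagMul measurable_fst
      (fun i => (hasACMarginals_summandMeasure S i).fst) none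
      (MeasurableSet.univ.prod measurableSet_Icc) map_fst_strip fun f => ?_, ?_⟩
    · convert isDiagMul_alphaRep S (f ⊗ₜ 1) using 2 with i
      rw [tensorToLInfty_tmul, map_one, mul_one]
    · exact (alphaRep_injective S).comp
        (Algebra.TensorProduct.includeLeft_injective (S := ℂ) (algebraMap ℂ LInftyReal).injective)
  isEmbedding_right := by
    refine ⟨isInducing_of_isDiagMul measurable_snd
      (fun i => (hasACMarginals_summandMeasure S i).snd) none
      (measurableSet_Icc.prod MeasurableSet.univ) map_snd_strip fun f => ?_, ?_⟩
    · convert isDiagMul_alphaRep S (1 ⊗ₜ f) using 2 with i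
      rw [tensorToLInfty_tmul, map_one, one_mul]
    · exact (alphaRep_injective S).comp
        (Algebra.TensorProduct.includeRight_injective (algebraMap ℂ LInftyReal).injective)

/-! ### Projections onto diagonal segments -/

/-- The class of the indicator function of a measurable set. -/
def LInfty.ind {X : Type*} [MeasurableSpace X] (μ : Measure X) {A : Set X} (hA : MeasurableSet A) :
    LInfty μ :=
  LInfty.mk (A.indicator fun _ => 1) ((memLp_top_const 1).indicator hA)

theorem LInfty.coe_ind {X : Type*} [MeasurableSpace X] (μ : Measure X) {A : Set X}
    (hA : MeasurableSet A) : LInfty.ind μ hA =ᵐ[μ] A.indicator fun _ => 1 :=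
  LInfty.coe_mk _ _

theorem LInfty.ae_norm_ind_le {X : Type*} [MeasurableSpace X] (μ : Measure X) {A : Set X}
    (hA : MeasurableSet A) : ∀ᵐ x ∂μ, ‖LInfty.ind μ hA x‖ ≤ 1 := by
  filter_upwards [LInfty.coe_ind μ hA] with x hx
  rw [hx]
  exact (norm_indicator_le_norm_self _ _).trans norm_one.le

/-- The projection in `B(⨁ᵢ L²(μᵢ))` which acts on every summand as multiplication by the indicator
function of `A`. -/
def diagProj {X ι : Type*} [MeasurableSpace X] (μ : ι → Measure X) {A : Set X}
    (hA : MeasurableSet A) :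
    lp (fun i => Lp ℂ 2 (μ i)) 2 →L[ℂ] lp (fun i => Lp ℂ 2 (μ i)) 2 :=
  lp.mapCLM 2 (fun i => LInfty.mulRep (μ i) (LInfty.ind (μ i) hA)) zero_le_one fun i =>
    ContinuousLinearMap.opNorm_le_bound _ zero_le_one fun ξ => by
      rw [one_mul]
      exact LInfty.norm_mulRep_apply_le _ (LInfty.ae_norm_ind_le _ hA) ξ

theorem isDiagMul_diagProj {X ι : Type*} [MeasurableSpace X] (μ : ι → Measure X) {A : Set X}
    (hA : MeasurableSet A) : IsDiagMul (diagProj μ hA) fun i => LInfty.ind (μ i) hA :=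
  fun _ _ => rfl

/-- The segment `{(s, x + s) : 0 ≤ s < 1}` of the diagonal shifted by `x`. -/
def segmentSet (x : ℝ) : Set (ℝ × ℝ) := {p | p.1 ∈ Set.Ico 0 1 ∧ p.2 = x + p.1}

theorem measurableSet_segmentSet (x : ℝ) : MeasurableSet (segmentSet x) :=
  (measurable_fst measurableSet_Ico).inter
    (measurableSet_eq_fun measurable_snd (measurable_fst.const_add x))

/-- The points `t` whose translate `t - x` lies in the grid interval `[j/(k+1), (j+1)/(k+1))`. -/
def gridInterval (x : ℝ) (k j : ℕ) : Set ℝ := {t | ⌊(k + 1) * (t - x)⌋ = (j : ℤ)}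

theorem measurableSet_gridInterval (x : ℝ) (k j : ℕ) : MeasurableSet (gridInterval x k j) :=
  (Int.measurable_floor.comp ((measurable_id.sub_const x).const_mul _))
    (measurableSet_singleton (j : ℤ))

/-- The union of the `k + 1` grid squares with side length `1/(k+1)` along the segment
`segmentSet x`. -/
def squares (x : ℝ) (k : ℕ) : Set (ℝ × ℝ) :=
  {p | ∃ j ∈ Finset.range (k + 1), p.1 ∈ gridInterval 0 k j ∧ p.2 ∈ gridInterval x k j}

/-- The projection in `L^∞(ℝ) ⊙ L^∞(ℝ)` given by the indicator function of `squares x k`. -/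
def squaresTensor (x : ℝ) (k : ℕ) : LInftyReal ⊗[ℂ] LInftyReal :=
  ∑ j ∈ Finset.range (k + 1), LInfty.ind volume (measurableSet_gridInterval 0 k j) ⊗ₜ
    LInfty.ind volume (measurableSet_gridInterval x k j)

theorem coe_tensorToLInfty_squaresTensor {μ : Measure (ℝ × ℝ)} (h : HasACMarginals μ) (x : ℝ)
    (k : ℕ) : tensorToLInfty μ h (squaresTensor x k) =ᵐ[μ] (squares x k).indicator fun _ => 1 := by
  classical
  rw [squaresTensor, map_sum]
  have hterm (j) : ∀ᵐ p ∂μ,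
      tensorToLInfty μ h (LInfty.ind volume (measurableSet_gridInterval 0 k j) ⊗ₜ
        LInfty.ind volume (measurableSet_gridInterval x k j)) p =
      if p.1 ∈ gridInterval 0 k j ∧ p.2 ∈ gridInterval x k j then 1 else 0 := by
    rw [tensorToLInfty_tmul]
    filter_upwards [LInfty.coe_mul
        (LInfty.comp Prod.fst h.fst (LInfty.ind volume (measurableSet_gridInterval 0 k j)))
        (LInfty.comp Prod.snd h.snd (LInfty.ind volume (measurableSet_gridInterval x k j))),
      LInfty.comp_apply Prod.fst h.fst (LInfty.ind volume (measurableSet_gridInterval 0 k j)),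
      LInfty.comp_apply Prod.snd h.snd (LInfty.ind volume (measurableSet_gridInterval x k j)),
      h.fst.ae (LInfty.coe_ind volume (measurableSet_gridInterval 0 k j)),
      h.snd.ae (LInfty.coe_ind volume (measurableSet_gridInterval x k j))] with p h1 h2 h3 h4 h5
    rw [h1, h2, h3, h4, h5, Set.indicator_apply, Set.indicator_apply, ite_and]
    split_ifs <;> simp
  have hall := (Finset.eventually_all (Finset.range (k + 1))).2 fun j _ => hterm j
  filter_upwards [hall, LInfty.coe_finset_sum (Finset.range (k + 1)) fun j =>
    tensorToLInfty μ h (LInfty.ind volume (measurableSet_gridInterval 0 k j) ⊗ₜ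
        LInfty.ind volume (measurableSet_gridInterval x k j))] with p h1 h2
  rw [h2, Finset.sum_congr rfl h1]
  by_cases hp : p ∈ squares x k
  · rw [Set.indicator_of_mem hp]
    obtain ⟨j, hj, hj1, hj2⟩ := hp
    rw [Finset.sum_eq_single_of_mem j hj, if_pos ⟨hj1, hj2⟩]
    -- a point lies in at most one of the squares
    exact fun i _ hij => if_neg fun hi => hij (by exact_mod_cast hi.1.symm.trans hj1)
  · rw [Set.indicator_of_notMem hp]
    exact Finset.sum_eq_zero fun j hj => if_neg fun h' => hp ⟨j, hj, h'⟩

theorem segmentSet_subset_squares (x : ℝ) (k : ℕ) : segmentSet x ⊆ squares x k := by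
  rintro ⟨s, t⟩ ⟨⟨h0, h1⟩, ht⟩
  obtain rfl : t = x + s := ht
  simp only at h0 h1
  have hk : (0 : ℝ) < k + 1 := by positivity
  obtain ⟨j, hj⟩ := Int.eq_ofNat_of_zero_le (Int.floor_nonneg.2 (mul_nonneg hk.le h0))
  refine ⟨j, Finset.mem_range.2 ?_, ?_, ?_⟩
  · have : ⌊((k : ℝ) + 1) * s⌋ < ((k + 1 : ℕ) : ℤ) := by
      rw [Int.floor_lt]
      push_cast
      nlinarith
    rw [hj] at this
    exact_mod_cast this
  · simpa [gridInterval] using hj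
  · simpa [gridInterval] using hj

theorem eventually_notMem_squares {x : ℝ} {p : ℝ × ℝ} (hp : p ∉ segmentSet x) :
    ∀ᶠ k in atTop, p ∉ squares x k := by
  obtain ⟨s, t⟩ := p
  obtain ⟨n, hn⟩ := exists_nat_gt (1 / |t - x - s|)
  filter_upwards [eventually_ge_atTop n] with k hk
  rintro ⟨j, hj, h1, h2⟩
  simp only [gridInterval, Set.mem_ofPred_eq, sub_zero, Int.floor_eq_iff, Int.cast_natCast]
    at h1 h2
  have hk0 : (0 : ℝ) < k + 1 := by positivity
  have hj' : (j : ℝ) + 1 ≤ k + 1 := by exact_mod_cast Finset.mem_range.1 hj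
  have hj0 : (0 : ℝ) ≤ j := j.cast_nonneg
  have hs0 : 0 ≤ s := nonneg_of_mul_nonneg_right (hj0.trans h1.1) hk0
  have hs1 : s < 1 := by nlinarith
  have hd : 0 < |t - x - s| := abs_pos.2 fun h => hp ⟨⟨hs0, hs1⟩, by simp only; linarith⟩
  have h3 : (k + 1) * |t - x - s| < 1 := by
    rw [← abs_of_pos hk0, ← abs_mul, abs_lt]
    constructor <;> linarith [h1.1, h1.2, h2.1, h2.2, mul_sub ((k : ℝ) + 1) (t - x) s]
  rw [div_lt_iff₀ hd] at hn
  have hnk : (n : ℝ) ≤ k + 1 := by exact_mod_cast hk.trans k.le_succ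
  nlinarith

theorem tendsto_indicator_squares (x : ℝ) (p : ℝ × ℝ) :
    Tendsto (fun k => (squares x k).indicator (fun _ => (1 : ℂ)) p) atTop
      (𝓝 ((segmentSet x).indicator (fun _ => 1) p)) := by
  by_cases hp : p ∈ segmentSet x
  · rw [Set.indicator_of_mem hp]
    refine tendsto_const_nhds.congr fun k => ?_
    rw [Set.indicator_of_mem (segmentSet_subset_squares x k hp)]
  · rw [Set.indicator_of_notMem hp]
    refine tendsto_const_nhds.congr' ?_
    filter_upwards [eventually_notMem_squares hp] with k hk
    rw [Set.indicator_of_notMem hk]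

theorem tendsto_alphaRep_squaresTensor (S : Set ℝ) (x : ℝ) :
    Tendsto (fun k => WeakStarB.of _ (alphaRep S (squaresTensor x k))) atTop
      (𝓝 (WeakStarB.of _ (diagProj (summandMeasure S) (measurableSet_segmentSet x)))) := by
  refine IsDiagMul.tendsto (fun k => isDiagMul_alphaRep S _) (isDiagMul_diagProj _ _)
    (fun k i => ?_) fun i => ?_
  · filter_upwards [coe_tensorToLInfty_squaresTensor (hasACMarginals_summandMeasure S i) x k]
      with p hp
    rw [hp]
    exact (norm_indicator_le_norm_self _ _).trans norm_one.le
  · filter_upwards [LInfty.coe_ind (summandMeasure S i) (measurableSet_segmentSet x),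
      ae_all_iff.2 fun k =>
        coe_tensorToLInfty_squaresTensor (hasACMarginals_summandMeasure S i) x k] with p h1 h2
    simp only [h1, h2]
    exact tendsto_indicator_squares x p

theorem diagProj_segmentSet_mem_weakStarTensor (S : Set ℝ) (x : ℝ) :
    WeakStarB.of _ (diagProj (summandMeasure S) (measurableSet_segmentSet x)) ∈
      weakStarTensor (alphaRep S) :=
  mem_closure_of_tendsto (tendsto_alphaRep_squaresTensor S x)
    (Eventually.of_forall fun k => ⟨squaresTensor x k, rfl⟩)

theorem diagProj_segmentSet_mul_alphaRep (S : Set ℝ) (x : ℝ) (k : ℕ) :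
    diagProj (summandMeasure S) (measurableSet_segmentSet x) * alphaRep S (squaresTensor x k) =
      diagProj (summandMeasure S) (measurableSet_segmentSet x) := by
  refine ContinuousLinearMap.ext fun ξ => lp.ext (funext fun i => ?_)
  rw [mul_apply_eq_comp, isDiagMul_diagProj, isDiagMul_diagProj, isDiagMul_alphaRep,
    ← mul_apply_eq_comp, ← map_mul]
  congr 2
  refine LInfty.ext ?_
  filter_upwards [LInfty.coe_ind (summandMeasure S i) (measurableSet_segmentSet x),
    coe_tensorToLInfty_squaresTensor (hasACMarginals_summandMeasure S i) x k,
    LInfty.coe_mul (LInfty.ind (summandMeasure S i) (measurableSet_segmentSet x))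
      (tensorToLInfty _ (hasACMarginals_summandMeasure S i) (squaresTensor x k))] with p h1 h2 h3
  rw [h3, h1, h2]
  by_cases hp : p ∈ segmentSet x
  · rw [Set.indicator_of_mem hp, Set.indicator_of_mem (segmentSet_subset_squares x k hp), mul_one]
  · rw [Set.indicator_of_notMem hp, zero_mul]

theorem summandMeasure_segmentSet_eq_zero {S : Set ℝ} {x : ℝ} (hx : x ∉ S) (i : Option S) :
    summandMeasure S i (segmentSet x) = 0 := by
  cases i with
  | none =>
    change (volume : Measure (ℝ × ℝ)) (segmentSet x) = 0
    rw [Measure.volume_eq_prod, Measure.measure_prod_null (measurableSet_segmentSet x)]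
    refine Eventually.of_forall fun s => ?_
    exact measure_mono_null (fun t (ht : (s, t) ∈ segmentSet x) => ht.2)
      (measure_singleton (x + s))
  | some y =>
    change (volume.map fun s : ℝ => (s, (y : ℝ) + s)) (segmentSet x) = 0
    rw [Measure.map_apply (by fun_prop) (measurableSet_segmentSet x)]
    convert measure_empty (μ := (volume : Measure ℝ))
    refine Set.eq_empty_of_forall_notMem fun s hs => hx ?_
    rw [← add_right_cancel hs.2]
    exact y.2

theorem diagProj_segmentSet_eq_zero {S : Set ℝ} {x : ℝ} (hx : x ∉ S) :
    diagProj (summandMeasure S) (measurableSet_segmentSet x) = 0 := by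
  refine ContinuousLinearMap.ext fun ξ => lp.ext (funext fun i => ?_)
  have h0 : LInfty.ind (summandMeasure S i) (measurableSet_segmentSet x) = 0 := LInfty.ext <| by
    filter_upwards [LInfty.coe_ind (summandMeasure S i) (measurableSet_segmentSet x),
      LInfty.coe_zero (μ := summandMeasure S i),
      compl_mem_ae_iff.2 (summandMeasure_segmentSet_eq_zero hx i)] with p h1 h2 h3
    rw [h1, h2, Set.indicator_of_notMem h3]
  refine (isDiagMul_diagProj _ _ ξ i).trans ?_
  simp only [h0, map_zero]
  rfl

theorem diagProj_segmentSet_ne_zero {S : Set ℝ} {x : ℝ} (hx : x ∈ S) :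
    diagProj (summandMeasure S) (measurableSet_segmentSet x) ≠ 0 := by
  classical
  intro h
  have hD := measurableSet_segmentSet x
  have hμ : summandMeasure S (some ⟨x, hx⟩) (segmentSet x) = 1 := by
    change (volume.map fun s : ℝ => (s, x + s)) (segmentSet x) = 1
    rw [Measure.map_apply (by fun_prop) hD]
    have : (fun s : ℝ => (s, x + s)) ⁻¹' segmentSet x = Set.Ico 0 1 := by
      ext s
      simp [segmentSet]
    rw [this]
    simp
  have hfin : summandMeasure S (some ⟨x, hx⟩) (segmentSet x) ≠ ∞ := by simp [hμ]
  -- the indicator function of the segment, a unit vector in the range of the projection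
  let ξ := indicatorConstLp 2 hD hfin (1 : ℂ)
  have h1 := isDiagMul_diagProj (summandMeasure S) hD (lp.single 2 (some ⟨x, hx⟩) ξ)
    (some ⟨x, hx⟩)
  rw [h, lp.single_apply_self] at h1
  have h2 : LInfty.mulRep _ (LInfty.ind _ hD) ξ = ξ := Lp.ext <| by
    filter_upwards [LInfty.mulRep_apply (LInfty.ind _ hD) ξ, LInfty.coe_ind _ hD,
      indicatorConstLp_coeFn (p := 2) (hs := hD) (hμs := hfin) (c := (1 : ℂ))] with p h1 h2 h3
    rw [h1, h2, h3]
    by_cases hp : p ∈ segmentSet x <;> simp [hp]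
  rw [h2] at h1
  have h3 : ‖ξ‖ = 1 := by
    rw [norm_indicatorConstLp two_ne_zero ENNReal.ofNat_ne_top, Measure.real, hμ]
    simp
  rw [← h1] at h3
  exact zero_ne_one (norm_zero.symm.trans h3)

/-! ### Nonequivalence -/

/-- If `x ∈ S` but `x ∉ T`, the projection `p` of the segment is nonzero and satisfies
`p α_S(q k) = p` for the tensors `q k = squaresTensor x k`, whereas `α_T(q k)` tends to `0`. Applying
a `*`-isomorphism `e` gives `e p = e p α_T(q k) → 0`. -/
theorem not_weakStarTensorEquiv_of_mem {S T : Set ℝ} {x : ℝ} (hS : x ∈ S) (hT : x ∉ T) :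
    ¬ WeakStarTensorEquiv (alphaRep S) (alphaRep T) := by
  rintro ⟨e, he⟩
  have he' (u) : e (toWeakStarTensor (alphaRep S) u) = toWeakStarTensor (alphaRep T) u := by
    have hadd {R : Set ℝ} (u v) : toWeakStarTensor (alphaRep R) (u + v) =
        toWeakStarTensor (alphaRep R) u + toWeakStarTensor (alphaRep R) v :=
      Subtype.ext (by simp only [toWeakStarTensor, map_add]; rfl)
    induction u with
    | zero =>
      have h0 {R : Set ℝ} : toWeakStarTensor (alphaRep R) 0 = 0 :=
        Subtype.ext (by simp only [toWeakStarTensor, map_zero]; rfl)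
      rw [h0, h0, map_zero]
    | tmul f g => exact he f g
    | add u v hu hv => rw [hadd, hadd, map_add, hu, hv]
  let p : weakStarTensor (alphaRep S) := ⟨_, diagProj_segmentSet_mem_weakStarTensor S x⟩
  have hp (k) : p * toWeakStarTensor (alphaRep S) (squaresTensor x k) = p :=
    Subtype.ext (diagProj_segmentSet_mul_alphaRep S x k)
  have hep (k) : ((e p : weakStarTensor (alphaRep T)) : WeakStarB (AlphaSpace T)) *
      WeakStarB.of _ (alphaRep T (squaresTensor x k)) = (e p : weakStarTensor (alphaRep T)) := by
    have := congrArg e (hp k)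
    rw [map_mul, he'] at this
    exact congrArg Subtype.val this
  have hlim := (tendsto_alphaRep_squaresTensor T x).const_mul
    ((e p : weakStarTensor (alphaRep T)) : WeakStarB (AlphaSpace T))
  simp only [hep, diagProj_segmentSet_eq_zero hT, map_zero, mul_zero] at hlim
  have h0 : e p = 0 := Subtype.ext (tendsto_nhds_unique tendsto_const_nhds hlim)
  have hp0 : p = 0 := (map_eq_zero_iff e e.injective).1 h0
  exact diagProj_segmentSet_ne_zero hS (congrArg Subtype.val hp0)

theorem WeakStarTensorEquiv.symm {M N H K : Type*}
    [Ring M] [StarRing M] [Algebra ℂ M] [StarModule ℂ M]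
    [Ring N] [StarRing N] [Algebra ℂ N] [StarModule ℂ N]
    [NormedAddCommGroup H] [InnerProductSpace ℂ H] [CompleteSpace H]
    [NormedAddCommGroup K] [InnerProductSpace ℂ K] [CompleteSpace K]
    {α : M ⊗[ℂ] N →⋆ₐ[ℂ] (H →L[ℂ] H)} {β : M ⊗[ℂ] N →⋆ₐ[ℂ] (K →L[ℂ] K)}
    (h : WeakStarTensorEquiv α β) : WeakStarTensorEquiv β α := by
  obtain ⟨e, he⟩ := h
  exact ⟨e.symm, fun a b => by rw [← he, StarAlgEquiv.symm_apply_apply]⟩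

end

theorem mainTheorem2 :
    (∀ S : Set ℝ, IsWeakStarTensorRep (alphaRep S)) ∧
    (∀ S T : Set ℝ, S ≠ T → ¬ WeakStarTensorEquiv (alphaRep S) (alphaRep T)) ∧
    Cardinal.mk (Set ℝ) = 2 ^ Cardinal.continuum := by
  refine ⟨isWeakStarTensorRep_alphaRep, fun S T hST h => hST (Set.ext fun x => ⟨?_, ?_⟩), ?_⟩
  · exact fun hS => by_contra fun hT => not_weakStarTensorEquiv_of_mem hS hT h
  · exact fun hT => by_contra fun hS => not_weakStarTensorEquiv_of_mem hT hS h.symm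
  · rw [Cardinal.mk_set, Cardinal.mk_real]
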